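/- For a positive integer $n$ let $\sigma(n)=\sum_{d\mid n} d$ be the sum of its positive divisors, and let $\gamma$ be the Euler–Mascheroni constant. Every squarefree integer $n\ge 2$ with $n\notin\{2,3,5,6,10,30\}$ satisfies Robin's inequality $$\sigma(n) < e^{\gamma}\, n\log\log n .$$ -/

import Mathlib

/-- Robin's inequality `σ(n) < e^γ n log log n`, where `σ(n)` is the sum of the divisors of `n`
and `γ` is the Euler-Mascheroni constant. (At `n = 1`, where `log log n` is undefined, the
convention `Real.log 0 = 0` makes the inequality false.) -/
def RobinInequality (n : ℕ) : Prop :=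
  (ArithmeticFunction.sigma 1 n : ℝ) <
    Real.exp Real.eulerMascheroniConstant * (n : ℝ) * Real.log (Real.log (n : ℝ))

/-- The set `𝓡` of the integers `n ≥ 1` that satisfy Robin's inequality. -/
def robinSet : Set ℕ := {n | 1 ≤ n ∧ RobinInequality n}

/-!
For squarefree `n` both `log (σ(n) / n) = ∑ p ∣ n, log (1 + 1 / p)` and `log n = ∑ p ∣ n, log p` are
sums over the prime divisors of `n`, so bounding `σ(n) / n` for a given size of `n` is a knapsack
problem. The ratio `log (1 + 1 / p) / log p` decreases with `p`, hence taking all primes up to some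
`z`, and correcting at the rate of `z`, gives an upper bound for `log (σ(n) / n)` that is affine in
`s = log n`. Robin's inequality asks for `log (σ(n) / n) < γ + log (log s)`, whose right-hand side
is concave in `s`. The values of `s` for which the affine bound suffices therefore form an interval,
and only endpoints need testing: `z = 13` settles `6.25 ≤ s ≤ 30` and `z = 199` settles
`30 ≤ s ≤ 900`. For `s ≥ 900` the choice `z = ⌊s⌋` works, by an explicit form of Mertens' theorem
obtained from the prime factorization of `N!`, Chebyshev's bound `θ(N) ≤ N log 4` and summation by
parts. The integers with `s < 6.25` are below `520` and leave a finite computation.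
-/

open Real Finset
open ArithmeticFunction (sigma sigma_pos sigma_one_apply isMultiplicative_sigma)

section Knapsack

theorem sum_le_sum_add_mul_sum_sub_sum {ι R : Type*} [DecidableEq ι] [Ring R] [PartialOrder R]
    [IsOrderedAddMonoid R] {s t : Finset ι} {f w : ι → R} {c : R}
    (hs : ∀ i ∈ s \ t, f i ≤ c * w i) (ht : ∀ i ∈ t \ s, c * w i ≤ f i) :
    ∑ i ∈ s, f i ≤ ∑ i ∈ t, f i + c * (∑ i ∈ s, w i - ∑ i ∈ t, w i) := by
  have h : ∑ i ∈ s, (f i - c * w i) ≤ ∑ i ∈ t, (f i - c * w i) :=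
    sum_sdiff_le_sum_sdiff.1 <|
      (sum_nonpos fun i hi => sub_nonpos.2 (hs i hi)).trans
        (sum_nonneg fun i hi => sub_nonneg.2 (ht i hi))
  rw [sum_sub_distrib, sum_sub_distrib, ← mul_sum, ← mul_sum, sub_le_iff_le_add] at h
  rw [mul_sub]
  exact h.trans_eq (by abel)

theorem log_one_add_one_div_nonneg {x : ℝ} (hx : 0 ≤ x) : 0 ≤ log (1 + 1 / x) :=
  log_nonneg (le_add_of_nonneg_right (by positivity))

theorem log_one_add_one_div_le {x : ℝ} (hx : 0 ≤ x) : log (1 + 1 / x) ≤ 1 / x := by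
  have := log_le_sub_one_of_pos (x := 1 + 1 / x) (by positivity)
  linarith

/-- The growth of `log (σ(n) / n)` per unit of `log n` when `n` is multiplied by a new prime `x`,
extended to real `x`. -/
noncomputable def abundancyRate (x : ℝ) : ℝ := log (1 + 1 / x) / log x

theorem abundancyRate_nonneg {x : ℝ} (hx : 1 ≤ x) : 0 ≤ abundancyRate x :=
  div_nonneg (log_one_add_one_div_nonneg (by linarith)) (log_nonneg hx)

theorem abundancyRate_mul_log {x : ℝ} (hx : 1 < x) :
    abundancyRate x * log x = log (1 + 1 / x) :=
  div_mul_cancel₀ _ (log_pos hx).ne'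

theorem abundancyRate_le {x : ℝ} (hx : 1 ≤ x) : abundancyRate x ≤ 1 / (x * log x) := by
  rw [← div_div]
  exact div_le_div_of_nonneg_right (log_one_add_one_div_le (by linarith)) (log_nonneg hx)

theorem antitoneOn_abundancyRate : AntitoneOn abundancyRate (Set.Ioi 1) := by
  intro x (hx : 1 < x) y (hy : 1 < y) hxy
  exact div_le_div₀ (log_one_add_one_div_nonneg (by linarith)) (by gcongr) (log_pos hx)
    (log_le_log (by linarith) hxy)

theorem sigma_one_eq_mul_prod_of_squarefree {n : ℕ} (hsq : Squarefree n) :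
    (sigma 1 n : ℝ) = n * ∏ p ∈ n.primeFactors, (1 + 1 / (p : ℝ)) := by
  have hσ : sigma 1 n = ∏ p ∈ n.primeFactors, (p + 1) := by
    rw [← isMultiplicative_sigma.prod_primeFactors hsq]
    refine prod_congr rfl fun p hp => ?_
    rw [sigma_one_apply, (Nat.prime_of_mem_primeFactors hp).sum_divisors]
  have hn : (n : ℝ) = ∏ p ∈ n.primeFactors, (p : ℝ) := by
    rw [← Nat.cast_prod, Nat.prod_primeFactors_of_squarefree hsq]
  rw [hσ, hn, ← prod_mul_distrib]
  push_cast
  refine prod_congr rfl fun p hp => ?_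
  have : (p : ℝ) ≠ 0 := Nat.cast_ne_zero.2 (Nat.prime_of_mem_primeFactors hp).ne_zero
  field_simp

theorem log_sigma_one_div_self_of_squarefree {n : ℕ} (hsq : Squarefree n) :
    log (sigma 1 n / n) = ∑ p ∈ n.primeFactors, log (1 + 1 / (p : ℝ)) := by
  rw [sigma_one_eq_mul_prod_of_squarefree hsq,
    mul_div_cancel_left₀ _ (Nat.cast_ne_zero.2 hsq.ne_zero), log_prod fun p _ => by positivity]

theorem log_eq_sum_primeFactors_of_squarefree {n : ℕ} (hsq : Squarefree n) :
    log n = ∑ p ∈ n.primeFactors, log p := by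
  conv_lhs => rw [← Nat.prod_primeFactors_of_squarefree hsq]
  push_cast
  exact log_prod fun p hp => Nat.cast_ne_zero.2 (Nat.prime_of_mem_primeFactors hp).ne_zero

/-- The upper bound for `log (σ(n) / n)`, over squarefree `n` with `log n = s`, that results from
filling `n` with the primes up to `z` and paying for the rest of `s` at the rate of `z`. -/
noncomputable def logAbundancyBound (z : ℕ) (s : ℝ) : ℝ :=
  ∑ p ∈ Nat.primesLE z, log (1 + 1 / (p : ℝ)) + abundancyRate z * (s - Chebyshev.theta z)

theorem log_sigma_one_div_self_le {n z : ℕ} (hsq : Squarefree n) (hz : 1 < z) :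
    log (sigma 1 n / n) ≤ logAbundancyBound z (log n) := by
  have hz' : (z : ℝ) ∈ Set.Ioi 1 := Set.mem_Ioi.2 (Nat.one_lt_cast.2 hz)
  rw [logAbundancyBound, log_sigma_one_div_self_of_squarefree hsq,
    log_eq_sum_primeFactors_of_squarefree hsq, Chebyshev.theta_eq_sum_primesLE_log]
  refine sum_le_sum_add_mul_sum_sub_sum (fun p hp => ?_) fun p hp => ?_
  · obtain ⟨hpn, hpz⟩ := mem_sdiff.1 hp
    have hprime := Nat.prime_of_mem_primeFactors hpn
    have hzp : z ≤ p := by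
      by_contra! h
      exact hpz (Nat.mem_primesLE.2 ⟨h.le, hprime⟩)
    have hp1 : (1 : ℝ) < p := Nat.one_lt_cast.2 hprime.one_lt
    rw [← abundancyRate_mul_log hp1]
    exact mul_le_mul_of_nonneg_right
      (antitoneOn_abundancyRate hz' hp1 (Nat.cast_le.2 hzp)) (log_pos hp1).le
  · obtain ⟨hpz, hprime⟩ := Nat.mem_primesLE.1 (mem_sdiff.1 hp).1
    have hp1 : (1 : ℝ) < p := Nat.one_lt_cast.2 hprime.one_lt
    rw [← abundancyRate_mul_log hp1]
    exact mul_le_mul_of_nonneg_right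
      (antitoneOn_abundancyRate hp1 hz' (Nat.cast_le.2 hpz)) (log_pos hp1).le

end Knapsack

section Window

/-- The values `s` of `log n` for which `logAbundancyBound z` is strong enough to imply Robin's
inequality. -/
def robinWindow (z : ℕ) : Set ℝ :=
  {s ∈ Set.Ioi 1 | logAbundancyBound z s < eulerMascheroniConstant + log (log s)}

theorem robinInequality_of_log_lt {n : ℕ} (hn : 1 < log n)
    (h : log (sigma 1 n / n) < eulerMascheroniConstant + log (log (log n))) :
    RobinInequality n := by
  have hll : 0 < log (log n) := log_pos hn
  have hn0 : n ≠ 0 := by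
    rintro rfl
    norm_num at hn
  have hσ : (0 : ℝ) < sigma 1 n := Nat.cast_pos.2 (sigma_pos 1 n hn0)
  have hn' : (0 : ℝ) < n := by positivity
  rw [log_lt_iff_lt_exp (by positivity), exp_add, exp_log hll, div_lt_iff₀ hn'] at h
  rw [RobinInequality]
  linarith

theorem robinInequality_of_log_mem_robinWindow {n z : ℕ} (hsq : Squarefree n) (hz : 1 < z)
    (h : log n ∈ robinWindow z) : RobinInequality n :=
  robinInequality_of_log_lt h.1 ((log_sigma_one_div_self_le hsq hz).trans_lt h.2)

theorem concaveOn_log_log : ConcaveOn ℝ (Set.Ioi 1) fun t : ℝ => log (log t) := by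
  have hsub : log '' Set.Ioi 1 ⊆ Set.Ioi 0 := Set.image_subset_iff.2 fun _ => log_pos
  have hcont : ContinuousOn log (Set.Ioi 1) :=
    continuousOn_log.mono fun t (ht : 1 < t) => (zero_lt_one.trans ht).ne'
  have hconv : Convex ℝ (log '' Set.Ioi 1) :=
    (isPreconnected_Ioi.image _ hcont).ordConnected.convex
  exact (strictConcaveOn_log_Ioi.concaveOn.subset hsub hconv).comp
    (strictConcaveOn_log_Ioi.concaveOn.subset (Set.Ioi_subset_Ioi zero_le_one) (convex_Ioi 1))
    (strictMonoOn_log.monotoneOn.mono hsub)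

theorem convexOn_logAbundancyBound (z : ℕ) {S : Set ℝ} (hS : Convex ℝ S) :
    ConvexOn ℝ S (logAbundancyBound z) := by
  refine ⟨hS, fun x _ y _ a b _ _ hab => le_of_eq ?_⟩
  obtain rfl := eq_sub_of_add_eq' hab
  simp only [logAbundancyBound, smul_eq_mul]
  ring

theorem convex_robinWindow (z : ℕ) : Convex ℝ (robinWindow z) := by
  have h := ((concaveOn_log_log.add_const eulerMascheroniConstant).sub
    (convexOn_logAbundancyBound z (convex_Ioi 1))).convex_gt 0
  simpa only [robinWindow, Pi.sub_apply, Pi.add_apply, sub_pos, add_comm (log _)] using h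

theorem logAbundancyBound_le_log {z k : ℕ} {s : ℝ} (hz : 1 < z)
    (hs : s ≤ Chebyshev.theta z + k * log z) :
    logAbundancyBound z s ≤
      log ((∏ p ∈ Nat.primesLE z, (1 + 1 / (p : ℝ))) * (1 + 1 / (z : ℝ)) ^ k) := by
  have hz' : (1 : ℝ) < z := Nat.one_lt_cast.2 hz
  rw [log_mul (prod_ne_zero_iff.2 fun p _ => by positivity) (by positivity),
    log_prod fun p _ => by positivity, log_pow, logAbundancyBound, ← abundancyRate_mul_log hz']
  have := mul_le_mul_of_nonneg_left (sub_le_iff_le_add'.2 hs) (abundancyRate_nonneg hz'.le)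
  linarith

theorem mem_robinWindow_of_prod_mul_pow_lt {z k : ℕ} {s : ℝ} (hz : 1 < z) (hs1 : 1 < s)
    (hs : s ≤ Chebyshev.theta z + k * log z)
    (h : (∏ p ∈ Nat.primesLE z, (1 + 1 / (p : ℝ))) * (1 + 1 / (z : ℝ)) ^ k <
      exp eulerMascheroniConstant * log s) :
    s ∈ robinWindow z := by
  refine ⟨hs1, (logAbundancyBound_le_log hz hs).trans_lt ?_⟩
  rwa [log_lt_iff_lt_exp (by positivity), exp_add, exp_log (log_pos hs1)]

end Window

section Mertens

theorem prod_primesLE_pow_div_dvd_factorial (N : ℕ) :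
    ∏ p ∈ Nat.primesLE N, p ^ (N / p) ∣ N.factorial := by
  refine prod_dvd_of_isRelPrime (fun p hp q hq hpq => ?_) fun p hp => ?_
  · exact Nat.coprime_iff_isRelPrime.1 <| Nat.coprime_pow_primes _ _
      (Nat.prime_of_mem_primesLE hp) (Nat.prime_of_mem_primesLE hq) hpq
  · have hprime := Nat.prime_of_mem_primesLE hp
    rw [hprime.pow_dvd_factorial_iff (b := Nat.log p N + 2) (by omega)]
    simpa only [pow_one] using single_le_sum (f := fun i => N / p ^ i) (fun _ _ => Nat.zero_le _)
      (mem_Ico.2 ⟨le_rfl, by omega⟩ : 1 ∈ Ico 1 (Nat.log p N + 2))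

theorem sum_primesLE_div_mul_log_le_log_factorial (N : ℕ) :
    ∑ p ∈ Nat.primesLE N, ((N / p : ℕ) : ℝ) * log p ≤ log N.factorial := by
  have hle : ∏ p ∈ Nat.primesLE N, (p : ℝ) ^ (N / p) ≤ N.factorial := by
    exact_mod_cast Nat.le_of_dvd N.factorial_pos (prod_primesLE_pow_div_dvd_factorial N)
  have hpos : ∀ p ∈ Nat.primesLE N, (0 : ℝ) < (p : ℝ) ^ (N / p) := fun p hp =>
    pow_pos (Nat.cast_pos.2 (Nat.prime_of_mem_primesLE hp).pos) _
  simpa only [log_prod fun p hp => (hpos p hp).ne', log_pow] using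
    log_le_log (prod_pos hpos) hle

theorem log_factorial_le {N : ℕ} (hN : 1 ≤ N) :
    log N.factorial ≤ N * log N - N + log N + 1 := by
  induction N, hN using Nat.le_induction with
  | base => simp
  | succ N hN ih =>
    have hN' : (0 : ℝ) < N := Nat.cast_pos.2 hN
    have hlog : 1 / ((N : ℝ) + 1) ≤ log (N + 1) - log N := by
      have h := one_sub_inv_le_log_of_pos (x := ((N : ℝ) + 1) / N) (by positivity)
      rw [log_div (by positivity) hN'.ne'] at h
      convert h using 1
      field_simp
      ring
    rw [div_le_iff₀ (by positivity)] at hlog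
    rw [Nat.factorial_succ, Nat.cast_mul, log_mul (by positivity) (by positivity)]
    push_cast
    linarith

theorem sum_log_div_primesLE_le {N : ℕ} (hN : N ≠ 0) :
    ∑ p ∈ Nat.primesLE N, log p / p ≤ log N + (log 4 - 1) + (log N + 1) / N := by
  have hN' : (0 : ℝ) < N := by positivity
  have hfloor : N * ∑ p ∈ Nat.primesLE N, log p / p - Chebyshev.theta N ≤ log N.factorial := by
    rw [Chebyshev.theta_eq_sum_primesLE_log, mul_sum, ← sum_sub_distrib]
    refine (sum_le_sum fun p _ => ?_).trans (sum_primesLE_div_mul_log_le_log_factorial N)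
    have hdiv : (N : ℝ) / p - 1 ≤ ((N / p : ℕ) : ℝ) := by
      rw [← Nat.floor_div_eq_div (K := ℝ)]
      exact (Nat.sub_one_lt_floor _).le
    calc N * (log p / p) - log p = ((N : ℝ) / p - 1) * log p := by ring
      _ ≤ ((N / p : ℕ) : ℝ) * log p := by gcongr
  have hθ := Chebyshev.theta_le_log4_mul_x hN'.le
  have hfact := log_factorial_le (Nat.one_le_iff_ne_zero.2 hN)
  refine le_of_mul_le_mul_left ?_ hN'
  rw [mul_add, mul_div_cancel₀ _ hN'.ne']
  linarith

/-- The error at `k` of the estimate for `∑ i ≤ k, g i` that summation by parts extracts from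
`∑ i ≤ k, g i * log i ≤ log k + C`. Under that hypothesis it is nonincreasing in `k`, which lets an
estimate be carried from one `k` to all larger ones. -/
noncomputable def abelDefect (g : ℕ → ℝ) (C : ℝ) (k : ℕ) : ℝ :=
  ∑ i ∈ Ioc 0 k, g i - (∑ i ∈ Ioc 0 k, g i * log i - C) / log k - log (log k)

theorem abelDefect_succ_le {g : ℕ → ℝ} {C : ℝ} {k : ℕ} (hk : 2 ≤ k)
    (hC : ∑ i ∈ Ioc 0 k, g i * log i ≤ log k + C) :
    abelDefect g C (k + 1) ≤ abelDefect g C k := by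
  have hk' : (1 : ℝ) < k := by exact_mod_cast hk
  rw [abelDefect, abelDefect, sum_Ioc_succ_top k.zero_le, sum_Ioc_succ_top k.zero_le]
  have hl : 0 < log k := log_pos hk'
  have hll : log k ≤ log (k + 1 : ℕ) := log_le_log (by linarith) (by push_cast; linarith)
  set l := log k
  set l' := log (k + 1 : ℕ)
  set A := ∑ i ∈ Ioc 0 k, g i * log i
  have hl' : 0 < l' := hl.trans_le hll
  have hloglog : 1 - l / l' ≤ log l' - log l := by
    have := one_sub_inv_le_log_of_pos (div_pos hl' hl)
    rwa [inv_div, log_div hl'.ne' hl.ne'] at this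
  have hA : (A - C) / l - (A - C) / l' ≤ 1 - l / l' := by
    have h : 0 ≤ (l - (A - C)) * (1 / l - 1 / l') :=
      mul_nonneg (by linarith) (sub_nonneg.2 (one_div_le_one_div_of_le hl hll))
    have e : (l - (A - C)) * (1 / l - 1 / l') =
        1 - l / l' - ((A - C) / l - (A - C) / l') := by
      field_simp
    linarith
  have hnew : (A + g (k + 1) * l' - C) / l' = (A - C) / l' + g (k + 1) := by
    field_simp
    ring
  linarith

theorem antitoneOn_abelDefect {g : ℕ → ℝ} {C : ℝ} {m : ℕ} (hm : 2 ≤ m)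
    (hC : ∀ k, m ≤ k → ∑ i ∈ Ioc 0 k, g i * log i ≤ log k + C) :
    AntitoneOn (abelDefect g C) (Set.Ici m) :=
  antitoneOn_nat_Ici_of_succ_le fun k hk => abelDefect_succ_le (hm.trans hk) (hC k hk)

theorem sum_le_log_log_add_abelDefect {g : ℕ → ℝ} {C : ℝ} {m N : ℕ} (hm : 2 ≤ m) (hmN : m ≤ N)
    (hC : ∀ k, m ≤ k → ∑ i ∈ Ioc 0 k, g i * log i ≤ log k + C) :
    ∑ i ∈ Ioc 0 N, g i ≤ log (log N) + 1 + abelDefect g C m := by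
  have hlog : 0 < log N := log_pos (Nat.one_lt_cast.2 (by omega))
  have hanti := antitoneOn_abelDefect hm hC Set.self_mem_Ici hmN hmN
  have hN : (∑ i ∈ Ioc 0 N, g i * log i - C) / log N ≤ 1 := by
    rw [div_le_one hlog]
    linarith [hC N hmN]
  rw [abelDefect] at hanti
  linarith

theorem sum_primesLE_eq_sum_Ioc (f : ℕ → ℝ) (N : ℕ) :
    ∑ p ∈ Nat.primesLE N, f p = ∑ i ∈ Ioc 0 N, if i.Prime then f i else 0 := by
  rw [Nat.primesLE_eq_filter_Ioc_zero, sum_filter]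

theorem sum_one_div_primesLE_le {C : ℝ} {m N : ℕ} (hm : 2 ≤ m) (hmN : m ≤ N)
    (hC : ∀ k, m ≤ k → ∑ p ∈ Nat.primesLE k, log p / p ≤ log k + C) :
    ∑ p ∈ Nat.primesLE N, 1 / (p : ℝ) ≤ ∑ p ∈ Nat.primesLE m, 1 / (p : ℝ) +
      (log (log N) - log (log m)) +
      (log m + C - ∑ p ∈ Nat.primesLE m, log p / p) / log m := by
  have hlog : log m ≠ 0 := (log_pos (Nat.one_lt_cast.2 hm)).ne'
  have hmul (k : ℕ) : ∑ i ∈ Ioc 0 k, (if i.Prime then 1 / (i : ℝ) else 0) * log i =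
      ∑ p ∈ Nat.primesLE k, log p / p := by
    rw [sum_primesLE_eq_sum_Ioc]
    refine sum_congr rfl fun i _ => ?_
    rw [ite_mul, zero_mul, one_div_mul_eq_div]
  have h := sum_le_log_log_add_abelDefect hm hmN fun k hk => (hmul k).trans_le (hC k hk)
  rw [abelDefect, hmul, ← sum_primesLE_eq_sum_Ioc, ← sum_primesLE_eq_sum_Ioc] at h
  rw [add_sub_assoc, add_div, div_self hlog, sub_div]
  rw [sub_div] at h
  linarith

theorem sum_log_one_add_one_div_primesLE_sub_le {m N : ℕ} (hmN : m ≤ N) :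
    ∑ p ∈ Nat.primesLE N, log (1 + 1 / (p : ℝ)) - ∑ p ∈ Nat.primesLE m, log (1 + 1 / (p : ℝ)) ≤
      ∑ p ∈ Nat.primesLE N, 1 / (p : ℝ) - ∑ p ∈ Nat.primesLE m, 1 / (p : ℝ) := by
  have hsub := Nat.primesLE_mono hmN
  rw [← sum_sdiff_eq_sub hsub, ← sum_sdiff_eq_sub hsub]
  exact sum_le_sum fun p _ => log_one_add_one_div_le p.cast_nonneg

end Mertens

section Numerics

theorem le_log_of_pow_le_pow {a b : ℕ} {x y : ℝ} (hb : 0 < b) (hx : 0 < x) (hy : b * y ≤ a)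
    (h : (2.7182818286 : ℝ) ^ a ≤ x ^ b) : y ≤ log x := by
  have hexp : exp a ≤ x ^ b := by
    rw [← exp_one_pow]
    exact (pow_le_pow_left₀ (exp_pos 1).le exp_one_lt_d9.le a).trans h
  have hlog : (a : ℝ) ≤ b * log x := by
    rwa [← log_pow, le_log_iff_exp_le (by positivity)]
  exact le_of_mul_le_mul_left (hy.trans hlog) (Nat.cast_pos.2 hb)

theorem eulerMascheroniConstant_gt : (0.573 : ℝ) < eulerMascheroniConstant := by
  refine lt_trans ?_ (eulerMascheroniSeq_lt_eulerMascheroniConstant 127)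
  have hharmonic : (5.4252 : ℝ) < harmonic 127 := by
    have h : (5.4252 : ℚ) < harmonic 127 := by decide +kernel
    have h' := (Rat.cast_lt (K := ℝ)).2 h
    push_cast at h'
    exact h'
  have hlog : log ((127 : ℕ) + 1) = 7 * log 2 := by
    rw [show ((127 : ℕ) + 1 : ℝ) = 2 ^ 7 by norm_num, log_pow, Nat.cast_ofNat]
  rw [eulerMascheroniSeq, hlog]
  linarith [log_two_lt_d9]

theorem exp_eulerMascheroniConstant_gt : (1.77 : ℝ) < exp eulerMascheroniConstant := by
  refine lt_of_lt_of_le ?_ (exp_le_exp.2 eulerMascheroniConstant_gt.le)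
  refine lt_of_lt_of_le ?_ (sum_le_exp_of_nonneg (by norm_num) 5)
  norm_num [sum_range_succ, Nat.factorial]

-- `68 / 25 = 2.72` replaces `e`, so that the hypothesis is a decidable inequality of integers.
theorem natCast_le_theta_add_mul_log {z k m : ℕ} (hz : 0 < z)
    (h : 68 ^ m ≤ 25 ^ m * (primorial z * z ^ k)) :
    (m : ℝ) ≤ Chebyshev.theta z + k * log z := by
  have hprim : (0 : ℝ) < primorial z := Nat.cast_pos.2 (primorial_pos z)
  have hpow : (68 / 25 : ℝ) ^ m ≤ primorial z * z ^ k := by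
    rw [div_pow, div_le_iff₀' (by positivity)]
    exact_mod_cast h
  rw [Chebyshev.theta_eq_log_primorial, Nat.floor_natCast, ← log_pow,
    ← log_mul hprim.ne' (by positivity), le_log_iff_exp_le (by positivity), ← exp_one_pow]
  exact (pow_le_pow_left₀ (exp_pos 1).le (by linarith [exp_one_lt_d9]) m).trans hpow

theorem prod_primesLE_13_lt : ∏ p ∈ Nat.primesLE 13, (1 + 1 / (p : ℝ)) < 3.223 := by
  have h : ∏ p ∈ Nat.primesLE 13, (1 + 1 / (p : ℚ)) < 3.223 := by decide +kernel
  have h' := (Rat.cast_lt (K := ℝ)).2 h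
  push_cast at h'
  exact h'

theorem prod_primesLE_199_lt : ∏ p ∈ Nat.primesLE 199, (1 + 1 / (p : ℝ)) < 5.86 := by
  have h : ∏ p ∈ Nat.primesLE 199, (1 + 1 / (p : ℚ)) < 5.86 := by decide +kernel
  have h' := (Rat.cast_lt (K := ℝ)).2 h
  push_cast at h'
  exact h'

theorem log2_pow_div_mul_log_two_le_log (n b : ℕ) :
    ((n ^ b).log2 : ℝ) / b * log 2 ≤ log n := by
  have h : ((n ^ b).log2 : ℝ) ≤ b * log n / log 2 := by
    have := natLog_le_logb (n ^ b) 2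
    rwa [← Nat.log2_eq_log_two, Nat.cast_pow, Nat.cast_ofNat, logb, log_pow] at this
  rw [le_div_iff₀ (log_pos one_lt_two)] at h
  rw [div_mul_eq_mul_div]
  exact div_le_of_le_mul₀ b.cast_nonneg (log_natCast_nonneg n) (h.trans_eq (mul_comm _ _))

theorem sum_log_div_primesLE_199_gt : (4.07 : ℝ) < ∑ p ∈ Nat.primesLE 199, log p / p := by
  -- `(p ^ 32).log2 / 32` is a computable lower approximation to `log p / log 2`.
  have h : (5.875 : ℝ) < ∑ p ∈ Nat.primesLE 199, ((p ^ 32).log2 : ℝ) / 32 / p := by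
    have h : (5.875 : ℚ) < ∑ p ∈ Nat.primesLE 199, ((p ^ 32).log2 : ℚ) / 32 / p := by
      decide +kernel
    have h' := (Rat.cast_lt (K := ℝ)).2 h
    push_cast at h'
    exact h'
  calc (4.07 : ℝ) < 5.875 * log 2 := by linarith [log_two_gt_d9]
    _ ≤ (∑ p ∈ Nat.primesLE 199, ((p ^ 32).log2 : ℝ) / 32 / p) * log 2 := by gcongr
    _ ≤ ∑ p ∈ Nat.primesLE 199, log p / p := by
      rw [sum_mul]
      refine sum_le_sum fun p _ => ?_
      rw [div_mul_eq_mul_div]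
      gcongr
      exact_mod_cast log2_pow_div_mul_log_two_le_log p 32

theorem le_log_199 : (37 / 7 : ℝ) ≤ log 199 :=
  le_log_of_pow_le_pow (a := 37) (b := 7) (by norm_num) (by norm_num) (by norm_num) (by norm_num)

theorem log_199_le : log 199 ≤ 5.3 := by
  have h : log 200 = 3 * log 2 + 2 * log 5 := by
    rw [show (200 : ℝ) = 2 ^ 3 * 5 ^ 2 by norm_num, log_mul (by norm_num) (by norm_num), log_pow,
      log_pow, Nat.cast_ofNat, Nat.cast_ofNat]
  have hmono : log 199 ≤ log 200 := log_le_log (by norm_num) (by norm_num)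
  linarith [log_two_lt_d9, log_five_lt_d9]

theorem le_log_30 : (3.4 : ℝ) ≤ log 30 :=
  le_log_of_pow_le_pow (a := 17) (b := 5) (by norm_num) (by norm_num) (by norm_num) (by norm_num)

theorem le_log_900 : (6.8 : ℝ) ≤ log 900 :=
  le_log_of_pow_le_pow (a := 34) (b := 5) (by norm_num) (by norm_num) (by norm_num) (by norm_num)

end Numerics

section LargeIntegers

theorem mem_robinWindow_of_prod_lt {z k m : ℕ} {P u s : ℝ} (hz : 1 < z) (hs1 : 1 < s)
    (hP : ∏ p ∈ Nat.primesLE z, (1 + 1 / (p : ℝ)) < P) (hu : u ≤ log s) (hsm : s ≤ m)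
    (hm : 68 ^ m ≤ 25 ^ m * (primorial z * z ^ k))
    (h : P * (1 + 1 / (z : ℝ)) ^ k ≤ 1.77 * u) : s ∈ robinWindow z := by
  have hγ := exp_eulerMascheroniConstant_gt
  refine mem_robinWindow_of_prod_mul_pow_lt hz hs1
    (hsm.trans (natCast_le_theta_add_mul_log (by omega) hm)) ?_
  calc (∏ p ∈ Nat.primesLE z, (1 + 1 / (p : ℝ))) * (1 + 1 / (z : ℝ)) ^ k
      < P * (1 + 1 / (z : ℝ)) ^ k := by gcongr
    _ ≤ 1.77 * u := h
    _ ≤ 1.77 * log s := by gcongr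
    _ ≤ exp eulerMascheroniConstant * log s := by
      gcongr
      exact (log_pos hs1).le

theorem Icc_subset_robinWindow_13 : Set.Icc 6.25 30 ⊆ robinWindow 13 := by
  refine (convex_robinWindow 13).ordConnected.out ?_ ?_
  · have hlog : (31 / 17 : ℝ) ≤ log 6.25 :=
      le_log_of_pow_le_pow (a := 31) (b := 17) (by norm_num) (by norm_num) (by norm_num)
        (by norm_num)
    exact mem_robinWindow_of_prod_lt (k := 0) (m := 10) (by norm_num) (by norm_num)
      prod_primesLE_13_lt hlog (by norm_num) (by decide +kernel) (by norm_num)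
  · exact mem_robinWindow_of_prod_lt (k := 8) (m := 30) (by norm_num) (by norm_num)
      prod_primesLE_13_lt le_log_30 (by norm_num) (by decide +kernel) (by norm_num)

theorem Icc_subset_robinWindow_199 : Set.Icc 30 900 ⊆ robinWindow 199 := by
  refine (convex_robinWindow 199).ordConnected.out ?_ ?_
  · exact mem_robinWindow_of_prod_lt (k := 0) (m := 30) (by norm_num) (by norm_num)
      prod_primesLE_199_lt le_log_30 (by norm_num) (by decide +kernel) (by norm_num)
  · exact mem_robinWindow_of_prod_lt (k := 140) (m := 900) (by norm_num) (by norm_num)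
      prod_primesLE_199_lt le_log_900 (by norm_num) (by decide +kernel) (by norm_num)

theorem sum_log_div_primesLE_le_log_add {k : ℕ} (hk : 199 ≤ k) :
    ∑ p ∈ Nat.primesLE k, log p / p ≤ log k + 0.418 := by
  have hk' : (199 : ℝ) ≤ k := by exact_mod_cast hk
  have hexp : exp 1 ≤ 199 := by linarith [exp_one_lt_d9]
  have hdiv : log k / k ≤ log 199 / 199 := log_div_self_antitoneOn hexp (hexp.trans hk') hk'
  have hinv : 1 / (k : ℝ) ≤ 1 / 199 := by gcongr
  have hlog4 : log 4 = 2 * log 2 := by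
    rw [show (4 : ℝ) = 2 ^ 2 by norm_num, log_pow, Nat.cast_ofNat]
  have h := sum_log_div_primesLE_le (N := k) (by omega)
  rw [add_div] at h
  linarith [log_two_lt_d9, log_199_le]

theorem sum_log_one_add_one_div_primesLE_199_le :
    ∑ p ∈ Nat.primesLE 199, log (1 + 1 / (p : ℝ)) ≤ log (log 199) + 0.109 := by
  have hlog := le_log_199
  have hpos : 0 < ∏ p ∈ Nat.primesLE 199, (1 + 1 / (p : ℝ)) := prod_pos fun p _ => by positivity
  have hquot := log_le_sub_one_of_pos (div_pos hpos (by linarith : 0 < log 199))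
  have hle : (∏ p ∈ Nat.primesLE 199, (1 + 1 / (p : ℝ))) / log 199 ≤ 1.109 := by
    rw [div_le_iff₀ (by linarith)]
    linarith [prod_primesLE_199_lt]
  rw [log_div hpos.ne' (by linarith), log_prod fun p _ => by positivity] at hquot
  linarith

theorem sum_log_one_add_one_div_primesLE_le {N : ℕ} (hN : 199 ≤ N) :
    ∑ p ∈ Nat.primesLE N, log (1 + 1 / (p : ℝ)) ≤ log (log N) + 0.42 := by
  have hlog := le_log_199
  have hrecip := sum_one_div_primesLE_le (by norm_num) hN
    fun k hk => sum_log_div_primesLE_le_log_add hk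
  have hboundary :
      (log 199 + 0.418 - ∑ p ∈ Nat.primesLE 199, log p / p) / log 199 ≤ 0.311 := by
    rw [div_le_iff₀ (by linarith)]
    linarith [log_199_le, sum_log_div_primesLE_199_gt]
  push_cast at hrecip
  linarith [sum_log_one_add_one_div_primesLE_sub_le hN, sum_log_one_add_one_div_primesLE_199_le]

theorem mem_robinWindow_floor {s : ℝ} (hs : 900 ≤ s) : s ∈ robinWindow ⌊s⌋₊ := by
  have hN : 900 ≤ ⌊s⌋₊ := Nat.le_floor (by exact_mod_cast hs)
  have hNs : (⌊s⌋₊ : ℝ) ≤ s := Nat.floor_le (by linarith)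
  have hsN : s < ⌊s⌋₊ + 1 := Nat.lt_floor_add_one s
  have hmertens := sum_log_one_add_one_div_primesLE_le (N := ⌊s⌋₊) (by omega)
  set N := ⌊s⌋₊
  have hN' : (900 : ℝ) ≤ N := by exact_mod_cast hN
  have hlog : (6.8 : ℝ) ≤ log N := le_log_900.trans (log_le_log (by norm_num) hN')
  have hmono : log (log N) ≤ log (log s) :=
    log_le_log (by linarith) (log_le_log (by linarith) hNs)
  have hrest : abundancyRate N * (s - Chebyshev.theta N) ≤ 0.148 := by
    calc abundancyRate N * (s - Chebyshev.theta N) ≤ abundancyRate N * s :=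
          mul_le_mul_of_nonneg_left (sub_le_self _ (Chebyshev.theta_nonneg _))
            (abundancyRate_nonneg (by linarith))
      _ ≤ 1 / (N * log N) * s := by gcongr; exact abundancyRate_le (by linarith)
      _ ≤ 0.148 := by
          rw [div_mul_eq_mul_div, div_le_iff₀ (by positivity)]
          have := mul_le_mul_of_nonneg_left hlog N.cast_nonneg
          linarith
  refine ⟨by simp only [Set.mem_Ioi]; linarith, ?_⟩
  rw [logAbundancyBound]
  linarith [eulerMascheroniConstant_gt]

theorem robinInequality_of_le_log {n : ℕ} (hsq : Squarefree n) (hn : 6.25 ≤ log n) :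
    RobinInequality n := by
  rcases le_total (log n) 30 with h30 | h30
  · exact robinInequality_of_log_mem_robinWindow hsq (by norm_num)
      (Icc_subset_robinWindow_13 ⟨hn, h30⟩)
  rcases le_total (log n) 900 with h900 | h900
  · exact robinInequality_of_log_mem_robinWindow hsq (by norm_num)
      (Icc_subset_robinWindow_199 ⟨h30, h900⟩)
  · exact robinInequality_of_log_mem_robinWindow hsq
      (Nat.le_floor (by norm_num; linarith)) (mem_robinWindow_floor h900)

end LargeIntegers

section SmallIntegers

theorem robinInequality_of_sigma_one_le {n : ℕ} {x q : ℝ} (hx : 1 < x) (hxn : x ≤ n) (hq : 0 < q)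
    (hqx : q ≤ 1.77 * log (log x)) (hσ : sigma 1 n ≤ q * n) : RobinInequality n := by
  have hn : (0 : ℝ) < n := by linarith
  have hmono : log (log x) ≤ log (log n) :=
    log_le_log (log_pos hx) (log_le_log (by linarith) hxn)
  have hpos : 0 < log (log n) := by linarith
  calc (sigma 1 n : ℝ) ≤ q * n := hσ
    _ ≤ 1.77 * log (log n) * n := by gcongr; linarith
    _ < exp eulerMascheroniConstant * log (log n) * n := by
      gcongr
      exact exp_eulerMascheroniConstant_gt
    _ = exp eulerMascheroniConstant * n * log (log n) := by ring

theorem le_log_log_7 : (0.65 : ℝ) ≤ log (log 7) := by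
  have hlog : (23 / 12 : ℝ) ≤ log 7 :=
    le_log_of_pow_le_pow (a := 23) (b := 12) (by norm_num) (by norm_num) (by norm_num) (by norm_num)
  exact le_log_of_pow_le_pow (a := 13) (b := 20) (by norm_num) (by linarith) (by norm_num)
    (le_trans (by norm_num) (pow_le_pow_left₀ (by norm_num) hlog 20))

theorem le_log_log_14 : (31 / 32 : ℝ) ≤ log (log 14) := by
  have hlog : (29 / 11 : ℝ) ≤ log 14 :=
    le_log_of_pow_le_pow (a := 29) (b := 11) (by norm_num) (by norm_num) (by norm_num) (by norm_num)
  exact le_log_of_pow_le_pow (a := 31) (b := 32) (by norm_num) (by linarith) (by norm_num)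
    (le_trans (by norm_num) (pow_le_pow_left₀ (by norm_num) hlog 32))

theorem le_log_log_42 : (1.3 : ℝ) ≤ log (log 42) := by
  have hlog : (3.7 : ℝ) ≤ log 42 :=
    le_log_of_pow_le_pow (a := 37) (b := 10) (by norm_num) (by norm_num) (by norm_num) (by norm_num)
  exact le_log_of_pow_le_pow (a := 13) (b := 10) (by norm_num) (by linarith) (by norm_num)
    (le_trans (by norm_num) (pow_le_pow_left₀ (by norm_num) hlog 10))

theorem le_log_log_210 : (1.6 : ℝ) ≤ log (log 210) := by
  have hlog : (5 : ℝ) ≤ log 210 :=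
    le_log_of_pow_le_pow (a := 5) (b := 1) (by norm_num) (by norm_num) (by norm_num) (by norm_num)
  exact le_log_of_pow_le_pow (a := 8) (b := 5) (by norm_num) (by linarith) (by norm_num)
    (le_trans (by norm_num) (pow_le_pow_left₀ (by norm_num) hlog 5))

-- Among squarefree integers other than 10 and 30, the records of `σ(n) / n` from 7 up to 520 are at
-- 7, 14, 42 and 210.
theorem sigma_one_le_of_squarefree_of_lt_520 :
    ∀ n ∈ Ico 7 520, Squarefree n → n ≠ 10 → n ≠ 30 → 35 * sigma 1 n ≤
      (if n < 14 then 40 else if n < 42 then 60 else if n < 210 then 80 else 96) * n := by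
  decide +kernel

theorem robinInequality_of_lt_520 {n : ℕ} (hn : 1 < n) (hn' : n < 520) (hsq : Squarefree n)
    (hB : n ∉ ({2, 3, 5, 6, 10, 30} : Set ℕ)) : RobinInequality n := by
  simp only [Set.mem_insert_iff, Set.mem_singleton_iff, not_or] at hB
  have h4 : n ≠ 4 := by
    rintro rfl
    exact absurd hsq (by decide +kernel)
  have hn7 : 7 ≤ n := by omega
  have hσ := sigma_one_le_of_squarefree_of_lt_520 n (mem_Ico.2 ⟨hn7, hn'⟩) hsq (by omega) (by omega)
  have hσ' : 35 * (sigma 1 n : ℝ) ≤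
      (if n < 14 then 40 else if n < 42 then 60 else if n < 210 then 80 else 96) * n := by
    exact_mod_cast hσ
  split_ifs at hσ' with h14 h42 h210
  · exact robinInequality_of_sigma_one_le (x := 7) (q := 8 / 7) (by norm_num)
      (by exact_mod_cast hn7) (by norm_num) (by linarith [le_log_log_7]) (by linarith)
  · exact robinInequality_of_sigma_one_le (x := 14) (q := 12 / 7) (by norm_num)
      (by exact_mod_cast not_lt.1 h14) (by norm_num) (by linarith [le_log_log_14]) (by linarith)
  · exact robinInequality_of_sigma_one_le (x := 42) (q := 16 / 7) (by norm_num)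
      (by exact_mod_cast not_lt.1 h42) (by norm_num) (by linarith [le_log_log_42]) (by linarith)
  · exact robinInequality_of_sigma_one_le (x := 210) (q := 96 / 35) (by norm_num)
      (by exact_mod_cast not_lt.1 h210) (by norm_num) (by linarith [le_log_log_210]) (by linarith)

end SmallIntegers

theorem theorem1 (n : ℕ) (hn : 1 < n) (hsq : Squarefree n)
    (hB : n ∉ ({2, 3, 5, 6, 10, 30} : Set ℕ)) : n ∈ robinSet := by
  refine ⟨hn.le, ?_⟩
  rcases lt_or_ge n 520 with hsmall | hlarge
  · exact robinInequality_of_lt_520 hn hsmall hsq hB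
  · have hlog : (6.25 : ℝ) ≤ log 520 :=
      le_log_of_pow_le_pow (a := 25) (b := 4) (by norm_num) (by norm_num) (by norm_num)
        (by norm_num)
    exact robinInequality_of_le_log hsq
      (hlog.trans (log_le_log (by norm_num) (by exact_mod_cast hlarge)))
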